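/- Let $(\Omega,\nu)$ be an atomless standard Borel probability space and let $W:\Omega^2\to[0,1]$ be a graphon, i.e. a symmetric measurable function. A function $c\in L^\infty(\Omega)$ is a *fractional vertex cover* of $W$ if $0\le c\le 1$ almost everywhere and the set $\{(x,y)\in\Omega^2: W(x,y)>0,\ c(x)+c(y)<1\}$ has $\nu^{\otimes 2}$-measure $0$. The set of all fractional vertex covers of $W$ is a convex subset of $L^\infty(\Omega)$, called the *fractional vertex cover polyton* of $W$. The graphon $W$ is *bipartite* if there is a partition $\Omega=\Omega_A\sqcup\Omega_B$ into two measurable sets of positive measure such that $W$ is zero almost everywhere on $(\Omega_A\times\Omega_A)\cup(\Omega_B\times\Omega_B)$. **Theorem.** If every extreme point of the fractional vertex cover polyton of $W$ is integral, i.e. takes values in $\{0,1\}$ almost everywhere, then $W$ is bipartite. -/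

import Mathlib

open MeasureTheory
open scoped ENNReal

/-- A graphon on `(Ω, ν)`: a symmetric `[0,1]`-valued function on `Ω × Ω` that is measurable for
the completion of the product measure `ν ⊗ ν` (in particular every Borel one is allowed). -/
structure Graphon {Ω : Type*} [MeasurableSpace Ω] (ν : Measure Ω) where
  toFun : Ω × Ω → ℝ
  aemeasurable' : AEMeasurable toFun (ν.prod ν)
  symm' : ∀ x y : Ω, toFun (x, y) = toFun (y, x)
  mem_Icc' : ∀ p : Ω × Ω, toFun p ∈ Set.Icc (0 : ℝ) 1

namespace Graphon

/-- The graphon `W` is bipartite if `Ω` can be partitioned into two sets of positive measure such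
that `W` vanishes almost everywhere on the two diagonal blocks. -/
def IsBipartite {Ω : Type*} [MeasurableSpace Ω] {ν : Measure Ω} (W : Graphon ν) : Prop :=
  ∃ A B : Set Ω, MeasurableSet A ∧ MeasurableSet B ∧ Disjoint A B ∧ A ∪ B = Set.univ ∧
    0 < ν A ∧ 0 < ν B ∧
    ∀ᵐ p ∂(ν.prod ν), p ∈ (A ×ˢ A) ∪ (B ×ˢ B) → W.toFun p = 0

/-- `c ∈ L^∞(Ω)` is a fractional vertex cover of `W` if `0 ≤ c ≤ 1` almost everywhere and the set
`supp W \ {(x, y) : c x + c y ≥ 1}` is null. -/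
def IsFractionalVertexCover {Ω : Type*} [MeasurableSpace Ω] {ν : Measure Ω} (W : Graphon ν)
    (c : Lp ℝ ∞ ν) : Prop :=
  (∀ᵐ x ∂ν, 0 ≤ c x ∧ c x ≤ 1) ∧
    (ν.prod ν) (Function.support W.toFun \ {p : Ω × Ω | c p.1 + c p.2 ≥ 1}) = 0

/-- The fractional vertex cover polyton of `W`, a subset of the vector space `L^∞(Ω)`. -/
def fracCoverPolyton {Ω : Type*} [MeasurableSpace Ω] {ν : Measure Ω} (W : Graphon ν) :
    Set (Lp ℝ ∞ ν) :=
  {c | W.IsFractionalVertexCover c}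

end Graphon

/-- An element of `L^∞(Ω)` is integral if its values are in `{0, 1}` almost everywhere. -/
def IsIntegralFunction {Ω : Type*} [MeasurableSpace Ω] {ν : Measure Ω} (c : Lp ℝ ∞ ν) : Prop :=
  ∀ᵐ x ∂ν, c x = 0 ∨ c x = 1

/-!
Translate a cover `c` to `c - 1 / 2`. The functions taking opposite values at the ends of almost
every edge are stable under odd functions and, by taking the first nonvanishing term, a countable
family of them can be merged into one supported on the union of their supports. By exhaustion one
of them, `f`, has a support containing all the others up to null sets. Then
`c = 1 / 2 + sign f / 2` is an extreme point of the polyton: if `c` lies in an open segment between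
two covers `u` and `v`, these are tight on every edge because `c` is, so that `u` is `1 / 2` off the
support of `f` by maximality, while `u = c` on it because there `c` takes the extreme values `0` and
`1`. By hypothesis `c` is integral, and since `c x + c y = 1` on almost every edge, the sets
`{c = 1}` and `{c ≠ 1}` are the two classes of a bipartition, except that one of them may be null;
in that case `W` vanishes almost everywhere, and any splitting of the space will do.
-/

open Filter

section Exhaustion

variable {α : Type*} [MeasurableSpace α] {C : Set (Set α)}

theorem exists_forall_measure_le_of_sUnion_mem (μ : Measure α) (hne : C.Nonempty)
    (hC : ∀ T ⊆ C, T.Countable → T.Nonempty → ⋃₀ T ∈ C) :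
    ∃ S ∈ C, ∀ A ∈ C, μ A ≤ μ S := by
  obtain ⟨u, -, hu, huC⟩ := exists_seq_tendsto_sSup (hne.image μ) (OrderTop.bddAbove _)
  choose T hTC hTu using huC
  refine ⟨⋃₀ Set.range T, hC _ (Set.range_subset_iff.2 hTC) (Set.countable_range T)
    (Set.range_nonempty T), fun A hA ↦ (le_sSup (Set.mem_image_of_mem μ hA)).trans ?_⟩
  exact le_of_tendsto' hu fun n ↦
    hTu n ▸ measure_mono (Set.subset_sUnion_of_mem (Set.mem_range_self n))

theorem exists_forall_ae_le_of_sUnion_mem (μ : Measure α) [SFinite μ] (hne : C.Nonempty)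
    (hmeas : ∀ A ∈ C, NullMeasurableSet A μ)
    (hC : ∀ T ⊆ C, T.Countable → T.Nonempty → ⋃₀ T ∈ C) :
    ∃ S ∈ C, ∀ A ∈ C, A ≤ᵐ[μ] S := by
  obtain ⟨S, hS, hmax⟩ := exists_forall_measure_le_of_sUnion_mem μ.toFinite hne hC
  refine ⟨S, hS, fun A hA ↦ (absolutelyContinuous_toFinite μ).ae_le ?_⟩
  have hunion : A ∪ S ∈ C :=
    Set.sUnion_pair A S ▸ hC {A, S} (Set.pair_subset hA hS) (Set.toFinite _).countable
      (Set.insert_nonempty A {S})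
  have hSeq : S =ᵐ[μ.toFinite] (A ∪ S : Set α) :=
    ae_eq_of_subset_of_measure_ge Set.subset_union_right (hmax _ hunion)
      ((hmeas S hS).mono_ac (toFinite_absolutelyContinuous μ)) (measure_ne_top _ _)
  exact Set.subset_union_left.eventuallyLE.trans hSeq.symm.le

end Exhaustion

section Splitting

variable {Ω : Type*} [MeasurableSpace Ω]

theorem exists_measurableSet_pos_and_compl_pos [MeasurableSpace.CountablySeparated Ω]
    (ν : Measure Ω) [NeZero ν] [NullSingletonClass ν] :
    ∃ A : Set Ω, MeasurableSet A ∧ 0 < ν A ∧ 0 < ν Aᶜ := by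
  by_contra! hsplit
  obtain ⟨s, hs, hsν⟩ := exists_subsingleton_mem_of_forall_separating (l := ae ν) MeasurableSet
    fun U hU ↦ by
      rcases eq_zero_or_pos (ν U) with hU0 | hUpos
      · exact Or.inr (compl_mem_ae_iff.2 hU0)
      · exact Or.inl (mem_ae_iff.2 (nonpos_iff_eq_zero.1 (hsplit U hU hUpos)))
  have hempty : ∅ ∈ ae ν := by
    simpa using inter_mem hsν (compl_mem_ae_iff.2 (hs.measure_zero ν))
  exact NeBot.ne inferInstance (empty_mem_iff_bot.1 hempty)

theorem ae_prod_fst_and_snd {ν : Measure Ω} {P : Ω → Prop} (h : ∀ᵐ x ∂ν, P x) :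
    ∀ᵐ p ∂(ν.prod ν), P p.1 ∧ P p.2 :=
  (Measure.quasiMeasurePreserving_fst.ae h).and (Measure.quasiMeasurePreserving_snd.ae h)

end Splitting

theorem coeFn_smul_add_smul {α 𝕜 E : Type*} [MeasurableSpace α] {μ : Measure α}
    [NormedRing 𝕜] [NormedAddCommGroup E] [Module 𝕜 E] [IsBoundedSMul 𝕜 E] {p : ℝ≥0∞}
    (a b : 𝕜) (u v : Lp E p μ) :
    ∀ᵐ x ∂μ, (a • u + b • v : Lp E p μ) x = a • u x + b • v x := by
  filter_upwards [Lp.coeFn_add (a • u) (b • v), Lp.coeFn_smul a u, Lp.coeFn_smul b v]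
    with x hadd hu hv
  simp only [hadd, Pi.add_apply, hu, hv, Pi.smul_apply]

theorem measurable_realSign : Measurable Real.sign :=
  .ite measurableSet_Iio measurable_const <|
    .ite measurableSet_Ioi measurable_const measurable_const

namespace Graphon

variable {Ω : Type*} [MeasurableSpace Ω] {ν : Measure Ω} {W : Graphon ν}

/-- `f` is skew for `W` if it takes opposite values at the two ends of almost every edge, that is,
of almost every point of the support of `W`. A cover `c` is tight on almost every edge if and only
if `c - 1 / 2` is skew. -/
def IsSkew (W : Graphon ν) (f : Ω → ℝ) : Prop :=
  ∀ᵐ p ∂(ν.prod ν), W.toFun p ≠ 0 → f p.2 = -f p.1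

namespace IsSkew

theorem zero : W.IsSkew 0 :=
  .of_forall fun _ _ ↦ neg_zero.symm

theorem comp_odd {f : Ω → ℝ} {φ : ℝ → ℝ} (hf : W.IsSkew f) (hφ : Function.Odd φ) :
    W.IsSkew (φ ∘ f) :=
  hf.mono fun p hp hW ↦ by rw [Function.comp_apply, hp hW, hφ, Function.comp_apply]

theorem congr_ae {f g : Ω → ℝ} (hf : W.IsSkew f) (hfg : f =ᵐ[ν] g) : W.IsSkew g := by
  filter_upwards [hf, ae_prod_fst_and_snd hfg] with p hp ⟨hfst, hsnd⟩
  rwa [← hfst, ← hsnd]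

/-- Take the first nonvanishing term at each point: both ends of an edge have the same index. -/
theorem exists_support_eq_iUnion {f : ℕ → Ω → ℝ} (hm : ∀ n, Measurable (f n))
    (hf : ∀ n, W.IsSkew (f n)) :
    ∃ g : Ω → ℝ, Measurable g ∧ W.IsSkew g ∧
      Function.support g = ⋃ n, Function.support (f n) := by
  classical
  have hex (x : Ω) : ∃ n, f n x ≠ 0 ∨ ∀ m, f m x = 0 := by
    by_contra! hx
    exact (hx 0).2.elim fun m hm ↦ hm (hx m).1
  have hmeas (n : ℕ) : MeasurableSet {x | f n x ≠ 0 ∨ ∀ m, f m x = 0} := by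
    measurability
  refine ⟨fun x ↦ f (Nat.find (hex x)) x, Measurable.find hm hmeas hex, ?_, ?_⟩
  · filter_upwards [ae_all_iff.2 hf] with p hp hW
    have hfind : Nat.find (hex p.2) = Nat.find (hex p.1) :=
      Nat.find_congr' fun {n} ↦ by simp only [hp _ hW, neg_eq_zero, ne_eq]
    simpa only [hfind] using hp _ hW
  · ext x
    simp only [Function.mem_support, Set.mem_iUnion]
    refine ⟨fun hx ↦ ⟨_, hx⟩, fun ⟨n, hn⟩ ↦ ?_⟩
    exact (Nat.find_spec (hex x)).resolve_right fun hzero ↦ hn (hzero n)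

end IsSkew

theorem exists_isSkew_maximal_support [SFinite ν] (W : Graphon ν) :
    ∃ f : Ω → ℝ, Measurable f ∧ W.IsSkew f ∧ ∀ g : Ω → ℝ, Measurable g → W.IsSkew g →
      Function.support g ≤ᵐ[ν] Function.support f := by
  obtain ⟨_, ⟨f, ⟨hfm, hf⟩, rfl⟩, hmax⟩ := exists_forall_ae_le_of_sUnion_mem ν
    (C := Function.support '' {f : Ω → ℝ | Measurable f ∧ W.IsSkew f})
    ⟨_, 0, ⟨measurable_zero, .zero⟩, rfl⟩
    (by rintro _ ⟨f, ⟨hfm, -⟩, rfl⟩; exact (measurableSet_support hfm).nullMeasurableSet)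
    (fun 𝒯 h𝒯 hcount hne ↦ by
      obtain ⟨T, rfl⟩ := hcount.exists_eq_range hne
      choose f hf hfT using Set.range_subset_iff.1 h𝒯
      obtain ⟨g, hgm, hg, hgf⟩ :=
        IsSkew.exists_support_eq_iUnion (fun n ↦ (hf n).1) fun n ↦ (hf n).2
      exact ⟨g, ⟨hgm, hg⟩, by simp only [hgf, hfT, Set.sUnion_range]⟩)
  exact ⟨f, hfm, hf, fun g hgm hg ↦ hmax _ ⟨g, ⟨hgm, hg⟩, rfl⟩⟩

theorem mem_fracCoverPolyton_iff_ae {c : Lp ℝ ∞ ν} :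
    c ∈ W.fracCoverPolyton ↔ (∀ᵐ x ∂ν, c x ∈ Set.Icc 0 1) ∧
      ∀ᵐ p ∂(ν.prod ν), W.toFun p ≠ 0 → 1 ≤ c p.1 + c p.2 := by
  refine and_congr Iff.rfl ?_
  simp only [measure_eq_zero_iff_ae_notMem, Set.mem_sdiff, Function.mem_support, Set.mem_ofPred_eq,
    not_and, not_not, ge_iff_le]

theorem isExtreme_fracCoverPolyton_isSkew (W : Graphon ν) :
    IsExtreme ℝ W.fracCoverPolyton {c ∈ W.fracCoverPolyton | W.IsSkew fun x ↦ c x - 1 / 2} := by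
  refine ⟨Set.sep_subset _ _, ?_⟩
  rintro u hu v hv _ ⟨-, hskew⟩ ⟨a, b, ha, hb, hab, rfl⟩
  refine ⟨hu, ?_⟩
  filter_upwards [(mem_fracCoverPolyton_iff_ae.1 hu).2, (mem_fracCoverPolyton_iff_ae.1 hv).2,
    hskew, ae_prod_fst_and_snd (coeFn_smul_add_smul a b u v)] with p hup hvp hp ⟨hfst, hsnd⟩ hW
  have hsum : a * (u p.1 + u p.2 - 1) + b * (v p.1 + v p.2 - 1) = 0 := by
    have hopp := hp hW
    simp only [hfst, hsnd, smul_eq_mul] at hopp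
    linear_combination hopp - hab
  have hu_excess : a * (u p.1 + u p.2 - 1) = 0 := by
    linarith [mul_nonneg ha.le (sub_nonneg.2 (hup hW)), mul_nonneg hb.le (sub_nonneg.2 (hvp hW))]
  linarith [(mul_eq_zero.1 hu_excess).resolve_left ha.ne']

theorem mem_extremePoints_fracCoverPolyton_of_isSkew {c : Lp ℝ ∞ ν}
    (hskew : W.IsSkew fun x ↦ c x - 1 / 2)
    (hval : ∀ᵐ x ∂ν, c x = 0 ∨ c x = 1 / 2 ∨ c x = 1)
    (hmax : ∀ g : Ω → ℝ, Measurable g → W.IsSkew g →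
      Function.support g ≤ᵐ[ν] Function.support fun x ↦ c x - 1 / 2) :
    c ∈ Set.extremePoints ℝ W.fracCoverPolyton := by
  have hc : c ∈ W.fracCoverPolyton := by
    refine mem_fracCoverPolyton_iff_ae.2 ⟨?_, ?_⟩
    · filter_upwards [hval] with x hx
      rcases hx with hx | hx | hx <;> norm_num [hx]
    · filter_upwards [hskew] with p hp hW
      linarith [hp hW]
  refine ⟨hc, fun u hu v hv hcuv ↦ Lp.ext ?_⟩
  have hu_skew : W.IsSkew fun x ↦ u x - 1 / 2 :=
    ((isExtreme_fracCoverPolyton_isSkew W).left_mem_of_mem_openSegment hu hv ⟨hc, hskew⟩ hcuv).2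
  have hu_half : ∀ᵐ x ∂ν, u x - 1 / 2 ≠ 0 → c x - 1 / 2 ≠ 0 :=
    hmax _ ((Lp.stronglyMeasurable u).measurable.sub_const _) hu_skew
  obtain ⟨a, b, ha, hb, hab, rfl⟩ := hcuv
  filter_upwards [hval, hu_half, (mem_fracCoverPolyton_iff_ae.1 hu).1,
    (mem_fracCoverPolyton_iff_ae.1 hv).1, coeFn_smul_add_smul a b u v] with x hx hxu hux hvx hxc
  by_cases hhalf : (a • u + b • v : Lp ℝ ∞ ν) x = 1 / 2
  · linarith [not_imp_not.1 hxu (sub_eq_zero.2 hhalf)]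
  · have hext : (a • u + b • v : Lp ℝ ∞ ν) x ∈ Set.extremePoints ℝ (Set.Icc (0 : ℝ) 1) := by
      rw [Set.extremePoints_Icc zero_le_one]
      tauto
    exact hext.2 hux hvx ⟨a, b, ha, hb, hab, hxc.symm⟩

theorem exists_mem_extremePoints_isSkew [SFinite ν] (W : Graphon ν) :
    ∃ c ∈ Set.extremePoints ℝ W.fracCoverPolyton, W.IsSkew fun x ↦ c x - 1 / 2 := by
  obtain ⟨f, hfm, hf, hmax⟩ := W.exists_isSkew_maximal_support
  let d : Ω → ℝ := fun x ↦ 1 / 2 + Real.sign (f x) / 2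
  have hdval (x : Ω) : d x = 0 ∨ d x = 1 / 2 ∨ d x = 1 := by
    rcases Real.sign_apply_eq (f x) with hx | hx | hx <;> norm_num [d, hx]
  have hdm : Measurable d := ((measurable_realSign.comp hfm).div_const 2).const_add _
  have hd : MemLp d ∞ ν := by
    refine memLp_top_of_bound hdm.aestronglyMeasurable 1 (.of_forall fun x ↦ ?_)
    rcases hdval x with hx | hx | hx <;> norm_num [hx]
  have hc : hd.toLp =ᵐ[ν] d := hd.coeFn_toLp
  have hsub : (fun x ↦ hd.toLp d x - 1 / 2) =ᵐ[ν] (fun t ↦ Real.sign t / 2) ∘ f :=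
    hc.mono fun x hx ↦ by simp only [hx, d, add_sub_cancel_left, Function.comp_apply]
  have hskew : W.IsSkew fun x ↦ hd.toLp d x - 1 / 2 :=
    (hf.comp_odd fun t ↦ by rw [Real.sign_neg, neg_div]).congr_ae hsub.symm
  refine ⟨hd.toLp, mem_extremePoints_fracCoverPolyton_of_isSkew hskew ?_ fun g hgm hg ↦ ?_, hskew⟩
  · exact hc.mono fun x hx ↦ hx ▸ hdval x
  · filter_upwards [hmax g hgm hg, hsub] with x hx hxsub hxg
    have hsign : Real.sign (f x) / 2 ≠ 0 :=
      div_ne_zero (mt Real.sign_eq_zero_iff.1 (hx hxg)) two_ne_zero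
    exact hxsub.trans_ne hsign

theorem exists_ae_eq_zero_on_blocks {c : Lp ℝ ∞ ν} (hskew : W.IsSkew fun x ↦ c x - 1 / 2)
    (hint : IsIntegralFunction c) :
    ∃ A, MeasurableSet A ∧ ∀ᵐ p ∂(ν.prod ν), p ∈ (A ×ˢ A) ∪ (Aᶜ ×ˢ Aᶜ) → W.toFun p = 0 := by
  refine ⟨c ⁻¹' {1}, (Lp.stronglyMeasurable c).measurable (measurableSet_singleton 1), ?_⟩
  filter_upwards [hskew, ae_prod_fst_and_snd hint] with p hp ⟨hfst, hsnd⟩ hblock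
  by_contra hW
  have hsum : c p.1 + c p.2 = 1 := by linarith [hp hW]
  rcases hblock with ⟨h1, h2⟩ | ⟨h1, h2⟩
  · norm_num [show c p.1 = 1 from h1, show c p.2 = 1 from h2] at hsum
  · norm_num [hfst.resolve_right h1, hsnd.resolve_right h2] at hsum

theorem isBipartite_of_measurableSet {A : Set Ω} (hA : MeasurableSet A) (hpos : 0 < ν A)
    (hcpos : 0 < ν Aᶜ)
    (h : ∀ᵐ p ∂(ν.prod ν), p ∈ (A ×ˢ A) ∪ (Aᶜ ×ˢ Aᶜ) → W.toFun p = 0) : W.IsBipartite :=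
  ⟨A, Aᶜ, hA, hA.compl, disjoint_compl_right, Set.union_compl_self A, hpos, hcpos, h⟩

theorem isBipartite_of_ae_eq_zero_on_blocks [MeasurableSpace.CountablySeparated Ω] [NeZero ν]
    [NullSingletonClass ν] {A : Set Ω} (hA : MeasurableSet A)
    (h : ∀ᵐ p ∂(ν.prod ν), p ∈ (A ×ˢ A) ∪ (Aᶜ ×ˢ Aᶜ) → W.toFun p = 0) : W.IsBipartite := by
  by_cases hpos : 0 < ν A ∧ 0 < ν Aᶜ
  · exact isBipartite_of_measurableSet hA hpos.1 hpos.2 h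
  have hblock : ∀ᵐ p ∂(ν.prod ν), p ∈ (A ×ˢ A) ∪ (Aᶜ ×ˢ Aᶜ) := by
    rcases not_and_or.1 hpos with hnull | hnull <;> rw [not_lt, nonpos_iff_eq_zero] at hnull
    · exact (ae_prod_fst_and_snd (compl_mem_ae_iff.2 hnull)).mono fun _ hp ↦ Or.inr hp
    · exact (ae_prod_fst_and_snd (mem_ae_iff.2 hnull)).mono fun _ hp ↦ Or.inl hp
  obtain ⟨B, hB, hBpos, hBcpos⟩ := exists_measurableSet_pos_and_compl_pos ν
  exact isBipartite_of_measurableSet hB hBpos hBcpos <|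
    (h.and hblock).mono fun _ hp _ ↦ hp.1 hp.2

end Graphon

theorem mainTheorem2_general {Ω : Type*} [MeasurableSpace Ω]
    [MeasurableSpace.CountablySeparated Ω] (ν : Measure Ω) [SFinite ν] [NeZero ν]
    [NullSingletonClass ν] (W : Graphon ν)
    (hW : ∀ c ∈ Set.extremePoints ℝ W.fracCoverPolyton, IsIntegralFunction c) :
    W.IsBipartite := by
  obtain ⟨c, hc, hskew⟩ := W.exists_mem_extremePoints_isSkew
  obtain ⟨A, hA, hblocks⟩ := Graphon.exists_ae_eq_zero_on_blocks hskew (hW c hc)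
  exact Graphon.isBipartite_of_ae_eq_zero_on_blocks hA hblocks

theorem mainTheorem2 {Ω : Type*} [MeasurableSpace Ω] [StandardBorelSpace Ω]
    (ν : Measure Ω) [IsProbabilityMeasure ν] [NullSingletonClass ν] (W : Graphon ν)
    (hW : ∀ c ∈ Set.extremePoints ℝ W.fracCoverPolyton, IsIntegralFunction c) :
    W.IsBipartite :=
  mainTheorem2_general ν W hW
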